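/- Let $K$ be a field of characteristic zero and let $R=K[x_1,x_2,x_3]$ with the standard grading. Let $I\subset R$ be an ideal such that - $R/I$ is Artinian; - $I$ is Borel-fixed, that is, $g(I)=I$ for every invertible upper triangular matrix $g=(g_{ij})\in GL(3;K)$, acting on $R$ by the $K$-algebra automorphism with $g\,x_j=\sum_{i=1}^{3} g_{ij}x_i$ (such an ideal is automatically a monomial ideal, hence graded); - $A=R/I=\bigoplus_{i\ge 0}A_i$ has the strong Lefschetz property (SLP), that is, there is a linear form $\ell\in A_1$ such that for all $i\ge 0$ and $s>0$ the multiplication map $\times\ell^s\colon A_i\to A_{i+s}$ has full rank (is injective or surjective). For a graded ideal $J\subset R$, the Hilbert function of $R/J$ is $t\mapsto\dim_K (R/J)_t$. A monomial ideal $J\subset R$ is called almost revlex if for every monomial $u$ in its minimal set of monomial generators, every monomial $v$ with $\deg v=\deg u$ and $v>_{\mathrm{revlex}}u$ belongs to $J$, where $>_{\mathrm{revlex}}$ is the graded reverse lexicographic order with $x_1>x_2>x_3$. Then $I$ is the unique almost revlex ideal of $R$ for the Hilbert function of $R/I$: the ideal $I$ is almost revlex, and if $J\subset R$ is an almost revlex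 ideal such that $R/J$ and $R/I$ have the same Hilbert function, then $J=I$. In particular, $I$ is uniquely determined by the Hilbert function: if $J\subset R$ is an ideal which is also Borel-fixed with $R/J$ Artinian and having the SLP, and $R/J$ and $R/I$ have the same Hilbert function, then $J=I$. -/

import Mathlib

namespace Lefschetz

open MvPolynomial

/-- The degree `t` component of `K[x₁,…,xₙ]/I`: the image of the forms of degree `t`. -/
noncomputable def quotientComponent {K : Type*} [Field K] {n : ℕ}
    (I : Ideal (MvPolynomial (Fin n) K)) (t : ℕ) :
    Submodule K (MvPolynomial (Fin n) K ⧸ I) :=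
  (homogeneousSubmodule (Fin n) K t).map (Ideal.Quotient.mkₐ K I).toLinearMap

/-- The Hilbert function of `K[x₁,…,xₙ]/I`. -/
noncomputable def hilbertFunction {K : Type*} [Field K] {n : ℕ}
    (I : Ideal (MvPolynomial (Fin n) K)) (t : ℕ) : ℕ :=
  Module.finrank K (quotientComponent I t)

/-- The strong Lefschetz property of a graded algebra `A = ⨁ᵢ 𝒜 i`: there is `ℓ ∈ 𝒜 1` such that
every multiplication map `ℓ ^ s : 𝒜 i → 𝒜 (i + s)`, `s > 0`, is of full rank, that is, injective
or surjective. -/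
def HasSLP {K A : Type*} [Field K] [CommRing A] [Algebra K A] (𝒜 : ℕ → Submodule K A) : Prop :=
  ∃ ℓ ∈ 𝒜 1, ∀ i s : ℕ, 0 < s →
    Set.InjOn (fun f => ℓ ^ s * f) (𝒜 i : Set A) ∨
      Set.SurjOn (fun f => ℓ ^ s * f) (𝒜 i : Set A) (𝒜 (i + s) : Set A)

/-- The action of a matrix on polynomials by `g xⱼ = ∑ᵢ gᵢⱼ xᵢ`. -/
noncomputable def linearSubst {K : Type*} [Field K] {n : ℕ} (g : Matrix (Fin n) (Fin n) K) :
    MvPolynomial (Fin n) K →ₐ[K] MvPolynomial (Fin n) K :=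
  aeval fun j => ∑ i, C (g i j) * X i

/-- `I` is Borel-fixed: `g(I) = I` for every invertible upper triangular matrix `g`. -/
def IsBorelFixed {K : Type*} [Field K] {n : ℕ} (I : Ideal (MvPolynomial (Fin n) K)) : Prop :=
  ∀ g : GL (Fin n) K, (g : Matrix (Fin n) (Fin n) K).BlockTriangular id →
    linearSubst (g : Matrix (Fin n) (Fin n) K) '' (I : Set (MvPolynomial (Fin n) K)) = I

/-- A monomial ideal is an ideal generated by a set of monomials. -/
def IsMonomialIdeal {K : Type*} [Field K] {n : ℕ} (I : Ideal (MvPolynomial (Fin n) K)) : Prop :=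
  ∃ S : Set (Fin n →₀ ℕ), I = Ideal.span ((fun u => monomial u (1 : K)) '' S)

/-- `x ^ v >_revlex x ^ u` in the graded reverse lexicographic order with `x₁ > ⋯ > xₙ`. -/
def RevlexGT {n : ℕ} (v u : Fin n →₀ ℕ) : Prop :=
  u.degree < v.degree ∨
    (u.degree = v.degree ∧ ∃ j, v j < u j ∧ ∀ i, j < i → v i = u i)

/-- `x ^ u` belongs to the minimal set of monomial generators of the monomial ideal `I`, which
consists of the monomials of `I` that are minimal for divisibility. -/
def IsMinimalGenerator {K : Type*} [Field K] {n : ℕ} (I : Ideal (MvPolynomial (Fin n) K))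
    (u : Fin n →₀ ℕ) : Prop :=
  Minimal (fun w => monomial w (1 : K) ∈ I) u

/-- Almost revlex ideals. -/
def IsAlmostRevlex {K : Type*} [Field K] {n : ℕ} (I : Ideal (MvPolynomial (Fin n) K)) : Prop :=
  IsMonomialIdeal I ∧ ∀ u, IsMinimalGenerator I u →
    ∀ v : Fin n →₀ ℕ, v.degree = u.degree → RevlexGT v u → monomial v (1 : K) ∈ I

end Lefschetz

/-!
Over a field of characteristic zero a Borel-fixed ideal `I` is a monomial ideal that is strongly
stable: exchanging a variable for an earlier one keeps a monomial in `I`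
(`IsBorelFixed.isMonomialIdeal`, `IsBorelFixed.monomial_exchange_mem`).

If moreover `R/I` has the strong Lefschetz property, then the last variable is itself a strong
Lefschetz element (`IsBorelFixed.last_isLefschetz`). Full rank of `ℓ ^ s` in one degree is an open
condition on the linear form `ℓ`, so `ℓ` may be assumed to involve the last variable, and then an
upper triangular substitution, which preserves `I`, takes the last variable to `ℓ`.

In three variables this makes `I` almost revlex (`IsBorelFixed.isAlmostRevlex`). Let `x ^ u` be a
minimal generator and `x ^ v` a revlex-larger monomial of the same degree. If `v₃ = u₃`, strong
stability gives `x ^ v ∈ I`. Otherwise `v₃ < u₃`. The monomial `x₁ ^ u₁ x₂ ^ u₂` is not in `I` by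
minimality, and `x₃ ^ u₃` carries it into `I`; so multiplication by `x₃ ^ u₃` is not injective on
its degree, hence is surjective onto the degree of `u`. Thus `x ^ v ∈ I + (x₃ ^ u₃)`, and since
`x₃ ^ u₃` does not divide `x ^ v`, it lies in `I`.

Finally, in any number of variables an almost revlex ideal is determined by its Hilbert function
(`IsAlmostRevlex.eq_of_hilbertFunction_eq`).
-/

namespace Lefschetz

open MvPolynomial

/-! ### Monomial ideals -/

section Monomial

variable {K : Type*} [Field K] {n : ℕ}

lemma monomial_mem_of_le {I : Ideal (MvPolynomial (Fin n) K)} {u v : Fin n →₀ ℕ} (h : u ≤ v)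
    (hu : monomial u (1 : K) ∈ I) : monomial v (1 : K) ∈ I :=
  I.mem_of_dvd (monomial_dvd_monomial.mpr ⟨Or.inr h, one_dvd _⟩) hu

lemma mem_of_forall_monomial_mem {I : Ideal (MvPolynomial (Fin n) K)} {p : MvPolynomial (Fin n) K}
    (h : ∀ v ∈ p.support, monomial v (1 : K) ∈ I) : p ∈ I := by
  rw [p.as_sum]
  refine I.sum_mem fun v hv => ?_
  rw [← mul_one (coeff v p), ← C_mul_monomial]
  exact I.mul_mem_left _ (h v hv)

lemma isMonomialIdeal_of_support {I : Ideal (MvPolynomial (Fin n) K)}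
    (h : ∀ p ∈ I, ∀ v ∈ p.support, monomial v (1 : K) ∈ I) : IsMonomialIdeal I := by
  refine ⟨{v | monomial v (1 : K) ∈ I}, le_antisymm (fun p hp => ?_) ?_⟩
  · exact mem_ideal_span_monomial_image.mpr fun v hv => ⟨v, h p hp v hv, le_rfl⟩
  · rw [Ideal.span_le]
    rintro _ ⟨v, hv, rfl⟩
    exact hv

lemma IsMonomialIdeal.monomial_mem {I : Ideal (MvPolynomial (Fin n) K)} (hI : IsMonomialIdeal I)
    {p : MvPolynomial (Fin n) K} (hp : p ∈ I) {v : Fin n →₀ ℕ} (hv : v ∈ p.support) :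
    monomial v (1 : K) ∈ I := by
  obtain ⟨S, rfl⟩ := hI
  obtain ⟨s, hs, hsv⟩ := mem_ideal_span_monomial_image.mp hp v hv
  exact monomial_mem_of_le hsv (Ideal.subset_span ⟨s, hs, rfl⟩)

lemma IsMonomialIdeal.le_of_forall_monomial {I J : Ideal (MvPolynomial (Fin n) K)}
    (hI : IsMonomialIdeal I) (h : ∀ u, monomial u (1 : K) ∈ I → monomial u (1 : K) ∈ J) :
    I ≤ J :=
  fun _ hp => mem_of_forall_monomial_mem fun v hv => h v (hI.monomial_mem hp hv)

end Monomial

/-! ### Almost revlex ideals are determined by the Hilbert function -/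

section Uniqueness

variable {K : Type*} [Field K] {n : ℕ}

lemma revlexGT_trichotomy {u v : Fin n →₀ ℕ} (hd : u.degree = v.degree) (hne : u ≠ v) :
    RevlexGT u v ∨ RevlexGT v u := by
  have hS : (Finset.univ.filter fun j => u j ≠ v j).Nonempty := by
    obtain ⟨j, hj⟩ := Finsupp.ne_iff.mp hne
    exact ⟨j, by simpa using hj⟩
  set j := (Finset.univ.filter fun j => u j ≠ v j).max' hS with hj
  have hmem : u j ≠ v j := by simpa using Finset.max'_mem _ hS
  have heq : ∀ i, j < i → u i = v i := fun i hi => by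
    by_contra hc
    exact absurd (Finset.le_max' _ i (by simpa using hc)) (not_le.mpr hi)
  rcases lt_or_gt_of_ne hmem with h | h
  · exact Or.inl (Or.inr ⟨hd.symm, j, h, heq⟩)
  · exact Or.inr (Or.inr ⟨hd, j, h, fun i hi => (heq i hi).symm⟩)

/-- The Hilbert function is strictly antitone along strict inclusions in a given degree. -/
lemma hilbertFunction_lt_of_monomial {I J : Ideal (MvPolynomial (Fin n) K)}
    (hI : IsMonomialIdeal I) {u : Fin n →₀ ℕ}
    (h : ∀ v, v.degree = u.degree → monomial v (1 : K) ∈ I → monomial v (1 : K) ∈ J)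
    (huI : monomial u (1 : K) ∉ I) (huJ : monomial u (1 : K) ∈ J) :
    hilbertFunction J u.degree < hilbertFunction I u.degree := by
  set t := u.degree with ht
  have : FiniteDimensional K (homogeneousSubmodule (Fin n) K t) :=
    Module.Finite.iff_fg.mpr (homogeneousSubmodule_fg _ _ t)
  -- the kernel of `R_t → R/L` is `L_t`
  let q (L : Ideal (MvPolynomial (Fin n) K)) :=
    (Ideal.Quotient.mkₐ K L).toLinearMap.domRestrict (homogeneousSubmodule (Fin n) K t)
  have hq (L : Ideal (MvPolynomial (Fin n) K)) (p : homogeneousSubmodule (Fin n) K t) :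
      p ∈ LinearMap.ker (q L) ↔ (p : MvPolynomial (Fin n) K) ∈ L := by
    simp [q, Ideal.Quotient.eq_zero_iff_mem]
  have hdim (L : Ideal (MvPolynomial (Fin n) K)) :
      hilbertFunction L t + Module.finrank K (LinearMap.ker (q L)) =
        Module.finrank K (homogeneousSubmodule (Fin n) K t) := by
    rw [← (q L).finrank_range_add_finrank_ker, LinearMap.range_domRestrict]
    rfl
  have hlt : LinearMap.ker (q I) < LinearMap.ker (q J) := by
    refine lt_of_le_of_ne (fun p hp => ?_) fun heq => ?_
    · rw [hq] at hp ⊢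
      refine mem_of_forall_monomial_mem fun v hv => h v ?_ (hI.monomial_mem hp hv)
      exact (IsHomogeneous.degree_eq_sum_deg_support p.2 hv).symm
    · let m : homogeneousSubmodule (Fin n) K t := ⟨monomial u 1, isHomogeneous_monomial 1 rfl⟩
      exact huI ((hq I m).mp (heq ▸ (hq J m).mpr huJ))
  have := Submodule.finrank_lt_finrank_of_lt hlt
  have h1 := hdim I
  have h2 := hdim J
  omega

/-- If two monomial ideals agree in degrees below that of `u`, and `x ^ u` lies in just one of
them, then it is a minimal generator of that one. -/
lemma isMinimalGenerator_of_agree {I J : Ideal (MvPolynomial (Fin n) K)} {u : Fin n →₀ ℕ}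
    (h : ∀ v, v.degree < u.degree → monomial v (1 : K) ∈ I → monomial v (1 : K) ∈ J)
    (huI : monomial u (1 : K) ∈ I) (huJ : monomial u (1 : K) ∉ J) : IsMinimalGenerator I u := by
  refine ⟨huI, fun w hw hwu => ?_⟩
  by_contra hc
  have hlt : w.degree < u.degree := by
    refine lt_of_le_of_ne (Finsupp.degree_mono hwu) fun he => hc ?_
    obtain ⟨c, rfl⟩ := le_iff_exists_add.mp hwu
    have : c.degree = 0 := by rw [map_add] at he; omega
    rw [(Finsupp.degree_eq_zero_iff c).mp this, add_zero]
  exact huJ (monomial_mem_of_le hwu (h w hlt hw))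

/-- Two almost revlex ideals with the same Hilbert function agree. In the first degree where they
differ, each has a minimal generator that is missing from the other one, and the revlex-larger
of two such generators lies in both. -/
theorem IsAlmostRevlex.eq_of_hilbertFunction_eq {I J : Ideal (MvPolynomial (Fin n) K)}
    (hI : IsAlmostRevlex I) (hJ : IsAlmostRevlex J)
    (h : hilbertFunction J = hilbertFunction I) : J = I := by
  have key : ∀ d, ∀ u : Fin n →₀ ℕ, u.degree = d →
      (monomial u (1 : K) ∈ I ↔ monomial u (1 : K) ∈ J) := by
    intro d
    induction d using Nat.strong_induction_on with
    | _ d ih =>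
      by_contra! hcon
      obtain ⟨w, hwd, hw⟩ := hcon
      have hu : ∃ u : Fin n →₀ ℕ, u.degree = d ∧ monomial u (1 : K) ∈ I ∧
          monomial u (1 : K) ∉ J := by
        by_contra! hc
        have hw' : monomial w (1 : K) ∉ I ∧ monomial w (1 : K) ∈ J := by
          have := hc w hwd
          tauto
        have := hilbertFunction_lt_of_monomial hI.1 (u := w)
          (fun v hv => hc v (hv.trans hwd)) hw'.1 hw'.2
        rw [h] at this
        exact this.false
      have hv : ∃ v : Fin n →₀ ℕ, v.degree = d ∧ monomial v (1 : K) ∈ J ∧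
          monomial v (1 : K) ∉ I := by
        by_contra! hc
        obtain ⟨u, hud, huI, huJ⟩ := hu
        have := hilbertFunction_lt_of_monomial hJ.1 (u := u)
          (fun v hv => hc v (hv.trans hud)) huJ huI
        rw [h] at this
        exact this.false
      obtain ⟨u, hud, huI, huJ⟩ := hu
      obtain ⟨v, hvd, hvJ, hvI⟩ := hv
      have hmu : IsMinimalGenerator I u :=
        isMinimalGenerator_of_agree (fun x hx => (ih _ (hud ▸ hx) x rfl).mp) huI huJ
      have hmv : IsMinimalGenerator J v :=
        isMinimalGenerator_of_agree (fun x hx => (ih _ (hvd ▸ hx) x rfl).mpr) hvJ hvI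
      rcases revlexGT_trichotomy (hud.trans hvd.symm) (fun e => hvI (e ▸ huI)) with hgt | hgt
      · exact huJ (hJ.2 v hmv u (hud.trans hvd.symm) hgt)
      · exact hvI (hI.2 u hmu v (hvd.trans hud.symm) hgt)
  exact le_antisymm (hJ.1.le_of_forall_monomial fun u => (key _ u rfl).mpr)
    (hI.1.le_of_forall_monomial fun u => (key _ u rfl).mp)

end Uniqueness

/-! ### Linear substitutions and Borel-fixed ideals -/

section Borel

variable {K : Type*} [Field K] {n : ℕ}

@[simp]
lemma linearSubst_X (g : Matrix (Fin n) (Fin n) K) (j : Fin n) :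
    linearSubst g (X j) = ∑ i, C (g i j) * X i :=
  aeval_X _ _

@[simp]
lemma linearSubst_one : linearSubst (1 : Matrix (Fin n) (Fin n) K) = AlgHom.id K _ := by
  ext1 j
  simp [Matrix.one_apply, apply_ite C, ite_mul]

lemma linearSubst_mul (g h : Matrix (Fin n) (Fin n) K) :
    linearSubst (g * h) = (linearSubst g).comp (linearSubst h) := by
  ext1 j
  simp only [linearSubst_X, AlgHom.comp_apply, map_sum, map_mul, Matrix.mul_apply,
    algHom_C, algebraMap_eq, Finset.mul_sum, Finset.sum_mul]
  rw [Finset.sum_comm]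
  exact Finset.sum_congr rfl fun _ _ => Finset.sum_congr rfl fun _ _ => by ring

lemma linearSubst_inv_apply (g : GL (Fin n) K) (p : MvPolynomial (Fin n) K) :
    linearSubst (g : Matrix (Fin n) (Fin n) K)
      (linearSubst ((g⁻¹ : GL (Fin n) K) : Matrix (Fin n) (Fin n) K) p) = p := by
  rw [← AlgHom.comp_apply, ← linearSubst_mul, ← Units.val_mul, mul_inv_cancel]
  simp

lemma linearSubst_apply_inv (g : GL (Fin n) K) (p : MvPolynomial (Fin n) K) :
    linearSubst ((g⁻¹ : GL (Fin n) K) : Matrix (Fin n) (Fin n) K)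
      (linearSubst (g : Matrix (Fin n) (Fin n) K) p) = p := by
  simpa using linearSubst_inv_apply g⁻¹ p

lemma linearSubst_isHomogeneous (g : Matrix (Fin n) (Fin n) K) {p : MvPolynomial (Fin n) K}
    {t : ℕ} (hp : p.IsHomogeneous t) : (linearSubst g p).IsHomogeneous t := by
  rw [← one_mul t]
  exact hp.aeval _ fun j => IsHomogeneous.sum _ _ _ fun i _ => isHomogeneous_C_mul_X _ _

lemma IsBorelFixed.linearSubst_mem_iff {I : Ideal (MvPolynomial (Fin n) K)} (hI : IsBorelFixed I)
    (g : GL (Fin n) K) (hg : (g : Matrix (Fin n) (Fin n) K).BlockTriangular id)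
    {p : MvPolynomial (Fin n) K} :
    linearSubst (g : Matrix (Fin n) (Fin n) K) p ∈ I ↔ p ∈ I := by
  have himg := hI g hg
  constructor
  · intro hp
    rw [← SetLike.mem_coe, ← himg] at hp
    obtain ⟨q, hq, hqp⟩ := hp
    rw [← linearSubst_apply_inv g p, ← hqp, linearSubst_apply_inv]
    exact hq
  · intro hp
    rw [← SetLike.mem_coe, ← himg]
    exact ⟨p, hp, rfl⟩

lemma coeff_linearSubst_diagonal (d : Fin n → K) (p : MvPolynomial (Fin n) K) (u : Fin n →₀ ℕ) :
    coeff u (linearSubst (Matrix.diagonal d) p) = (∏ i, d i ^ u i) * coeff u p := by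
  induction p using MvPolynomial.induction_on' with
  | monomial v a =>
    have hX (j : Fin n) : linearSubst (Matrix.diagonal d) (X j) = C (d j) * X j := by
      rw [linearSubst_X, Finset.sum_eq_single j] <;> simp +contextual
    have : linearSubst (Matrix.diagonal d) (monomial v a) =
        monomial v ((∏ i, d i ^ v i) * a) := by
      rw [monomial_eq, Finsupp.prod_fintype _ _ (by simp), map_mul, map_prod]
      simp only [map_pow, hX, mul_pow, Finset.prod_mul_distrib, algHom_C, algebraMap_eq]
      rw [monomial_eq, Finsupp.prod_fintype _ _ (by simp)]
      simp only [map_mul, map_prod, map_pow]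
      ring
    rw [this, coeff_monomial, coeff_monomial]
    split_ifs with h
    · rw [h]
    · simp
  | add p q hp hq => rw [map_add, coeff_add, hp, hq, coeff_add, mul_add]

variable [CharZero K]

/-- Borel-fixed ideals are monomial. If two monomials `x ^ u`, `x ^ v` occur in `p ∈ I` and
`u j ≠ v j`, then doubling `x j` and subtracting `2 ^ u j * p` removes `x ^ u` from the support of
`p` and retains `x ^ v`; repeating this isolates each monomial of `p`. -/
theorem IsBorelFixed.isMonomialIdeal {I : Ideal (MvPolynomial (Fin n) K)} (hI : IsBorelFixed I) :
    IsMonomialIdeal I := by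
  refine isMonomialIdeal_of_support fun p hp v hv => ?_
  induction hN : p.support.card using Nat.strong_induction_on generalizing p with
  | _ N ih =>
    by_cases hall : ∀ u ∈ p.support, u = v
    · have hpv : p = monomial v (coeff v p) := by
        ext u
        rw [coeff_monomial]
        split_ifs with h
        · rw [h]
        · by_contra hc
          exact h (hall u (mem_support_iff.mpr hc)).symm
      have := I.mul_mem_left (C (coeff v p)⁻¹) hp
      rwa [hpv, C_mul_monomial, coeff_monomial, if_pos rfl,
        inv_mul_cancel₀ (mem_support_iff.mp hv)] at this
    · push Not at hall
      obtain ⟨u, hu, huv⟩ := hall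
      obtain ⟨j, hj⟩ := Finsupp.ne_iff.mp huv
      let d : Fin n → K := Function.update 1 j 2
      have hd (w : Fin n →₀ ℕ) : ∏ i, d i ^ w i = 2 ^ w j := by
        rw [Finset.prod_eq_single j] <;> simp +contextual [d, Function.update_of_ne]
      have hdet : IsUnit (Matrix.diagonal d).det := by
        rw [Matrix.det_diagonal]
        simpa using (show IsUnit (∏ i, d i ^ (Finsupp.equivFunOnFinite.symm 1 : Fin n →₀ ℕ) i) by
          rw [hd]; simp)
      let g : GL (Fin n) K := Matrix.GeneralLinearGroup.mk'' (Matrix.diagonal d) hdet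
      have hgp : linearSubst (Matrix.diagonal d) p ∈ I :=
        (hI.linearSubst_mem_iff g (Matrix.blockTriangular_diagonal d)).mpr hp
      set q := linearSubst (Matrix.diagonal d) p - C (2 ^ u j) * p with hq
      have hqc (w : Fin n →₀ ℕ) : coeff w q = (2 ^ w j - 2 ^ u j) * coeff w p := by
        rw [hq, coeff_sub, coeff_linearSubst_diagonal, hd, coeff_C_mul]
        ring
      have hss : q.support ⊂ p.support := by
        refine (Finset.ssubset_iff_of_subset fun w hw => ?_).mpr ⟨u, hu, by simp [hqc]⟩
        rw [mem_support_iff, hqc] at hw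
        exact mem_support_iff.mpr (right_ne_zero_of_mul hw)
      refine ih _ (hN ▸ Finset.card_lt_card hss) q (I.sub_mem hgp (I.mul_mem_left _ hp)) ?_ rfl
      rw [mem_support_iff, hqc]
      refine mul_ne_zero (sub_ne_zero.mpr fun h => hj ?_) (mem_support_iff.mp hv)
      exact (Nat.pow_right_injective le_rfl (by exact_mod_cast h)).symm

/-- Borel-fixed ideals are strongly stable in characteristic zero: part of a power of `x j` may be
replaced by the same power of `x i` for `i < j`. The new monomial occurs in the image of the old
one under `x j ↦ x j + x i`, with a binomial coefficient. -/
theorem IsBorelFixed.monomial_exchange_mem {I : Ideal (MvPolynomial (Fin n) K)}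
    (hI : IsBorelFixed I) {i j : Fin n} (hij : i < j) {w : Fin n →₀ ℕ} (hw : w j = 0) (k l : ℕ)
    (h : monomial (w + Finsupp.single j (k + l)) (1 : K) ∈ I) :
    monomial (w + (Finsupp.single j k + Finsupp.single i l)) (1 : K) ∈ I := by
  let g : GL (Fin n) K := Matrix.GeneralLinearGroup.mk'' (Matrix.transvection i j 1)
    (by rw [Matrix.det_transvection_of_ne _ _ hij.ne]; exact isUnit_one)
  have hgT : (Matrix.transvection i j (1 : K)).BlockTriangular id := fun a b hab => by
    have hab' : b < a := hab
    have : ¬ (i = a ∧ j = b) := by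
      rintro ⟨rfl, rfl⟩
      exact absurd hij hab'.not_gt
    simp [Matrix.transvection, hab'.ne', this]
  have hX (a : Fin n) : linearSubst (Matrix.transvection i j (1 : K)) (X a) =
      X a + if a = j then X i else 0 := by
    rw [linearSubst_X]
    simp only [Matrix.transvection, Matrix.add_apply, map_add, add_mul, Finset.sum_add_distrib]
    congr 1
    · simp [Matrix.one_apply, apply_ite C, ite_mul]
    · rw [Finset.sum_eq_single i] <;>
        simp +contextual [Matrix.single_apply, eq_comm, apply_ite C, ite_mul]
  have hgw : linearSubst (Matrix.transvection i j (1 : K)) (monomial w 1) = monomial w 1 := by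
    rw [monomial_eq, Finsupp.prod_fintype _ _ (by simp), map_mul, map_prod, algHom_C,
      algebraMap_eq]
    congr 1
    refine Finset.prod_congr rfl fun a _ => ?_
    rw [map_pow, hX]
    split_ifs with ha
    · rw [ha, hw, pow_zero, pow_zero]
    · rw [add_zero]
  have himg : linearSubst (Matrix.transvection i j (1 : K))
      (monomial (w + Finsupp.single j (k + l)) 1) = monomial w 1 * (X j + X i) ^ (k + l) := by
    have hsplit : monomial (w + Finsupp.single j (k + l)) (1 : K) =
        monomial w 1 * X j ^ (k + l) := by
      rw [X_pow_eq_monomial, monomial_mul, mul_one]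
    rw [hsplit, map_mul, hgw, map_pow, hX, if_pos rfl]
  have hmem : monomial w 1 * (X j + X i) ^ (k + l) ∈ I := by
    rw [← himg]
    exact (hI.linearSubst_mem_iff g hgT).mpr h
  refine hI.isMonomialIdeal.monomial_mem hmem (mem_support_iff.mpr ?_)
  rw [coeff_monomial_mul, one_mul, add_pow, coeff_sum]
  have hterm (m : ℕ) : coeff (Finsupp.single j k + Finsupp.single i l)
      (X j ^ m * X i ^ (k + l - m) * ((k + l).choose m : MvPolynomial (Fin n) K)) =
      if m = k then ((k + l).choose m : K) else 0 := by
    rw [X_pow_eq_monomial, X_pow_eq_monomial, monomial_mul, mul_one, ← map_natCast C, mul_comm,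
      C_mul_monomial, coeff_monomial, mul_one]
    refine if_congr ⟨fun he => ?_, ?_⟩ rfl rfl
    · simpa [hij.ne, hij.ne'] using DFunLike.congr_fun he j
    · rintro rfl
      simp
  simp only [hterm]
  rw [Finset.sum_ite_eq' _ k, if_pos (Finset.mem_range.mpr (by omega))]
  exact Nat.cast_ne_zero.mpr (Nat.choose_pos (by omega)).ne'

end Borel

/-! ### The last variable is a Lefschetz element -/

section LastVariable

/-- Bijectivity is an open condition in a polynomial family of endomorphisms: a family which is
the identity at `t = 0` fails to be bijective for finitely many `t` only, the roots of its
determinant. -/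
lemma finite_setOf_not_bijective {K V : Type*} [Field K] [AddCommGroup V] [Module K V]
    [FiniteDimensional K V] (F : ℕ → Module.End K V) (hF : F 0 = 1) (s : ℕ) :
    {t : K | ¬ Function.Bijective ⇑(∑ k ∈ Finset.range (s + 1), t ^ k • F k : Module.End K V)}.Finite := by
  classical
  let b := Module.finBasis K V
  let M : Matrix _ _ (Polynomial K) := ∑ k ∈ Finset.range (s + 1),
    (Polynomial.X : Polynomial K) ^ k • (LinearMap.toMatrix b b (F k)).map Polynomial.C
  have hM (t : K) : M.det.eval t =
      LinearMap.det (∑ k ∈ Finset.range (s + 1), t ^ k • F k) := by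
    rw [← LinearMap.det_toMatrix b, ← Polynomial.coe_evalRingHom, RingHom.map_det]
    congr 1
    ext i j
    simp [M, Matrix.sum_apply, map_sum]
    exact Finset.sum_congr rfl fun _ _ => mul_comm _ _
  have hM0 : M.det ≠ 0 := fun h => by
    have := hM 0
    rw [h, Finset.sum_range_succ', Finset.sum_eq_zero (by simp)] at this
    simp [hF] at this
  refine (Polynomial.finite_setOfPred_isRoot hM0).subset fun t ht => ?_
  by_contra hc
  refine ht ?_
  rw [Set.mem_ofPred_eq, Polynomial.IsRoot, hM] at hc
  exact (Module.End.isUnit_iff _).mp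
    ((LinearMap.isUnit_iff_isUnit_det _).mpr (isUnit_iff_ne_zero.mpr hc))

/-- The full rank of the powers of a linear form persists under perturbation: if `ℓ ^ s` is
injective or surjective from `V` to `W`, then so is `(ℓ + t x) ^ s` for all but finitely
many `t`. -/
lemma finite_setOf_not_full_rank {K A : Type*} [Field K] [CommRing A] [Algebra K A]
    (V W : Submodule K A) [FiniteDimensional K V] [FiniteDimensional K W] (ℓ x : A) (s : ℕ)
    (hVW : ∀ t : K, ∀ f ∈ V, (ℓ + t • x) ^ s * f ∈ W)
    (h : Set.InjOn (fun f => ℓ ^ s * f) (V : Set A) ∨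
      Set.SurjOn (fun f => ℓ ^ s * f) (V : Set A) (W : Set A)) :
    {t : K | ¬ (Set.InjOn (fun f => (ℓ + t • x) ^ s * f) (V : Set A) ∨
      Set.SurjOn (fun f => (ℓ + t • x) ^ s * f) (V : Set A) (W : Set A))}.Finite := by
  let c (k : ℕ) : A := x ^ k * ℓ ^ (s - k) * (s.choose k : A)
  have hc (t : K) : (ℓ + t • x) ^ s = ∑ k ∈ Finset.range (s + 1), t ^ k • c k := by
    rw [add_comm, add_pow]
    simp [c, smul_pow]
  have hc0 : c 0 = ℓ ^ s := by simp [c]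
  let m (k : ℕ) : V →ₗ[K] A := LinearMap.mulLeft K (c k) ∘ₗ V.subtype
  have hm (t : K) (v : V) :
      (∑ k ∈ Finset.range (s + 1), t ^ k • m k) v = (ℓ + t • x) ^ s * (v : A) := by
    simp [hc, m, Finset.sum_mul]
  rcases h with h | h
  · -- compose with a retraction of `ℓ ^ s`
    have hker : LinearMap.ker (m 0) = ⊥ := LinearMap.ker_eq_bot.mpr fun v w hvw =>
      Subtype.ext (h v.2 w.2 (by simpa [m, hc0] using hvw))
    obtain ⟨r, hr⟩ := (m 0).exists_leftInverse_of_injective hker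
    refine (finite_setOf_not_bijective (fun k => r ∘ₗ m k) hr s).subset fun t ht hbij => ?_
    refine ht (Or.inl fun v hv w hw hvw => ?_)
    have hr' (v : V) : (∑ k ∈ Finset.range (s + 1), t ^ k • (r ∘ₗ m k)) v =
        r ((ℓ + t • x) ^ s * (v : A)) := by
      rw [← hm]
      simp
    refine congrArg Subtype.val (hbij.1 (a₁ := ⟨v, hv⟩) (a₂ := ⟨w, hw⟩) ?_)
    rw [hr', hr']
    exact congrArg r hvw
  · -- compose with a section of `ℓ ^ s`
    obtain ⟨π, hπ⟩ := W.subtype.exists_leftInverse_of_injective W.ker_subtype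
    have hπ' {a : A} (ha : a ∈ W) : (π a : A) = a :=
      congrArg Subtype.val (LinearMap.congr_fun hπ ⟨a, ha⟩)
    have hsurj : LinearMap.range (π ∘ₗ m 0) = ⊤ := by
      refine LinearMap.range_eq_top.mpr fun w => ?_
      obtain ⟨v, hv, hvw⟩ := h w.2
      refine ⟨⟨v, hv⟩, ?_⟩
      have : m 0 ⟨v, hv⟩ = w := by simpa [m, hc0] using hvw
      rw [LinearMap.comp_apply, this]
      exact LinearMap.congr_fun hπ w
    obtain ⟨σ, hσ⟩ := (π ∘ₗ m 0).exists_rightInverse_of_surjective hsurj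
    refine (finite_setOf_not_bijective (fun k => π ∘ₗ m k ∘ₗ σ)
      (by rw [← LinearMap.comp_assoc]; exact hσ) s).subset fun t ht hbij => ?_
    refine ht (Or.inr fun w hw => ?_)
    obtain ⟨w', hw'⟩ := hbij.2 ⟨w, hw⟩
    refine ⟨σ w', (σ w').2, ?_⟩
    have : (∑ k ∈ Finset.range (s + 1), t ^ k • (π ∘ₗ m k ∘ₗ σ)) w' =
        π ((ℓ + t • x) ^ s * (σ w' : A)) := by
      rw [← hm]
      simp
    rw [this] at hw'
    exact (hπ' (hVW t _ (σ w').2)).symm.trans (congrArg Subtype.val hw')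

variable {K : Type*} [Field K] {n : ℕ}

instance finiteDimensional_quotientComponent (I : Ideal (MvPolynomial (Fin n) K)) (t : ℕ) :
    FiniteDimensional K (quotientComponent I t) :=
  Module.Finite.iff_fg.mpr ((homogeneousSubmodule_fg _ _ t).map _)

lemma mem_quotientComponent {I : Ideal (MvPolynomial (Fin n) K)} {t : ℕ}
    {a : MvPolynomial (Fin n) K ⧸ I} :
    a ∈ quotientComponent I t ↔
      ∃ p : MvPolynomial (Fin n) K, p.IsHomogeneous t ∧ Ideal.Quotient.mk I p = a :=
  Iff.rfl

lemma exists_eq_sum_of_isHomogeneous_one {p : MvPolynomial (Fin n) K} (hp : p.IsHomogeneous 1) :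
    ∃ c : Fin n → K, p = ∑ i, C (c i) * X i := by
  have : p ∈ homogeneousSubmodule (Fin n) K 1 := hp
  rw [homogeneousSubmodule_one_eq_span_X, Submodule.mem_span_range_iff_exists_fun] at this
  obtain ⟨c, hc⟩ := this
  exact ⟨c, by simp [← hc, smul_eq_C_mul]⟩

/-- For a Borel-fixed ideal, multiplication by a power of a linear form in which `x_n` occurs may
be replaced by multiplication by the same power of `x_n`: an upper triangular substitution takes
`x_n` to that form. -/
lemma IsBorelFixed.full_rank_last {I : Ideal (MvPolynomial (Fin (n + 1)) K)}
    (hI : IsBorelFixed I) {c : Fin (n + 1) → K} (hc : c (Fin.last n) ≠ 0) {i s : ℕ}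
    (h : Set.InjOn (fun f => Ideal.Quotient.mk I (∑ i, C (c i) * X i) ^ s * f)
          (quotientComponent I i : Set _) ∨
      Set.SurjOn (fun f => Ideal.Quotient.mk I (∑ i, C (c i) * X i) ^ s * f)
          (quotientComponent I i : Set _) (quotientComponent I (i + s) : Set _)) :
    (∀ p : MvPolynomial (Fin (n + 1)) K, p.IsHomogeneous i → X (Fin.last n) ^ s * p ∈ I → p ∈ I) ∨
      ∀ p : MvPolynomial (Fin (n + 1)) K, p.IsHomogeneous (i + s) →
        ∃ q, p - X (Fin.last n) ^ s * q ∈ I := by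
  let M : Matrix (Fin (n + 1)) (Fin (n + 1)) K := (1 : Matrix _ _ K).updateCol (Fin.last n) c
  have hMT : M.BlockTriangular id := fun a b hab => by
    have hab' : b < a := hab
    have hb : b ≠ Fin.last n := (hab'.trans_le (Fin.le_last a)).ne
    simp [M, hb, hab'.ne']
  have hdet : IsUnit M.det := by
    rw [Matrix.det_of_isUpperTriangular hMT, Finset.prod_eq_single (Fin.last n)]
    · simpa [M] using hc
    · intro b _ hb
      simp [M, hb]
    · simp
  let g : GL (Fin (n + 1)) K := Matrix.GeneralLinearGroup.mk'' M hdet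
  have hg (p) : linearSubst M p ∈ I ↔ p ∈ I := hI.linearSubst_mem_iff g hMT
  have hX : linearSubst M (X (Fin.last n)) = ∑ i, C (c i) * X i := by
    simp [M]
  rcases h with h | h
  · refine Or.inl fun p hp hpI => ?_
    rw [← hg, map_mul, map_pow, hX] at hpI
    rw [← hg, ← Ideal.Quotient.eq_zero_iff_mem]
    refine h (mem_quotientComponent.mpr ⟨_, linearSubst_isHomogeneous M hp, rfl⟩)
      (Submodule.zero_mem _) ?_
    simpa only [map_mul, map_pow, mul_zero] using Ideal.Quotient.eq_zero_iff_mem.mpr hpI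
  · refine Or.inr fun p hp => ?_
    obtain ⟨a, ha, hap⟩ := h (mem_quotientComponent.mpr ⟨_, linearSubst_isHomogeneous M hp, rfl⟩)
    obtain ⟨r, -, rfl⟩ := mem_quotientComponent.mp ha
    refine ⟨linearSubst ((g⁻¹ : GL (Fin (n + 1)) K) : Matrix _ _ K) r, ?_⟩
    rw [← hg, map_sub, map_mul, map_pow, hX,
      show linearSubst M (linearSubst ((g⁻¹ : GL (Fin (n + 1)) K) : Matrix _ _ K) r) = r from
        linearSubst_inv_apply g r, ← Ideal.Quotient.eq]
    simpa using hap.symm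

/-- For a Borel-fixed ideal with the strong Lefschetz property, the last variable is a strong
Lefschetz element. -/
theorem IsBorelFixed.last_isLefschetz [Infinite K] {I : Ideal (MvPolynomial (Fin (n + 1)) K)}
    (hI : IsBorelFixed I) (hS : HasSLP (quotientComponent I)) (i : ℕ) {s : ℕ} (hs : 0 < s) :
    (∀ p : MvPolynomial (Fin (n + 1)) K, p.IsHomogeneous i → X (Fin.last n) ^ s * p ∈ I → p ∈ I) ∨
      ∀ p : MvPolynomial (Fin (n + 1)) K, p.IsHomogeneous (i + s) →
        ∃ q, p - X (Fin.last n) ^ s * q ∈ I := by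
  obtain ⟨_, hℓ, hfull⟩ := hS
  obtain ⟨L, hL, rfl⟩ := mem_quotientComponent.mp hℓ
  obtain ⟨c, rfl⟩ := exists_eq_sum_of_isHomogeneous_one hL
  let x := Ideal.Quotient.mk I (X (Fin.last n))
  -- the perturbed form `ℓ + t x_n` and its coefficients
  let c' (t : K) : Fin (n + 1) → K := c + Pi.single (Fin.last n) t
  have hc' (t : K) : Ideal.Quotient.mk I (∑ i, C (c i) * X i) + t • x =
      Ideal.Quotient.mk I (∑ i, C (c' t i) * X i) := by
    have h1 : ∑ i, C (c' t i) * X i = ∑ i, C (c i) * X i + t • X (Fin.last n) := by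
      simp only [c', Pi.add_apply, map_add, add_mul, Finset.sum_add_distrib]
      congr 1
      rw [Finset.sum_eq_single (Fin.last n)] <;> simp +contextual [smul_eq_C_mul]
    rw [h1, map_add]
    rfl
  have hfin := finite_setOf_not_full_rank (quotientComponent I i) (quotientComponent I (i + s))
    (Ideal.Quotient.mk I (∑ i, C (c i) * X i)) x s (fun t f hf => by
      obtain ⟨p, hp, rfl⟩ := mem_quotientComponent.mp hf
      rw [hc', ← map_pow, ← map_mul]
      refine mem_quotientComponent.mpr ⟨_, ?_, rfl⟩
      have := ((IsHomogeneous.sum Finset.univ (fun i => C (c' t i) * X i) 1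
        fun i _ => isHomogeneous_C_mul_X _ _).pow s).mul hp
      rwa [one_mul, add_comm s i] at this) (hfull i s hs)
  obtain ⟨t, ht⟩ := (hfin.union (Set.finite_singleton (-c (Fin.last n)))).exists_notMem
  rw [Set.mem_union, not_or, Set.mem_ofPred_eq, not_not, hc'] at ht
  refine hI.full_rank_last (c := c' t) (fun h0 => ht.2 ?_) ht.1
  have : c (Fin.last n) + t = 0 := by simpa [c'] using h0
  exact eq_neg_of_add_eq_zero_right this

end LastVariable

/-! ### Three variables -/

/-- A Borel-fixed ideal in three variables with the strong Lefschetz property is almost revlex. -/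
theorem IsBorelFixed.isAlmostRevlex {K : Type*} [Field K] [CharZero K]
    {I : Ideal (MvPolynomial (Fin 3) K)} (hI : IsBorelFixed I)
    (hS : HasSLP (quotientComponent I)) : IsAlmostRevlex I := by
  refine ⟨hI.isMonomialIdeal, fun u hu v hdeg hgt => ?_⟩
  have hdeg' : v 0 + v 1 + v 2 = u 0 + u 1 + u 2 := by
    simpa [Finsupp.degree_eq_sum, Fin.sum_univ_three] using hdeg
  rcases hgt with hlt | ⟨-, j, hj, heq⟩
  · exact absurd hdeg hlt.ne'
  have hlast : Fin.last 2 = (2 : Fin 3) := rfl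
  fin_cases j
  · have h1 : v 1 = u 1 := heq 1 (by decide)
    have h2 : v 2 = u 2 := heq 2 (by decide)
    have h0 : v 0 < u 0 := hj
    omega
  · -- the exponents of `x₃` agree, and `v` arises from `u` by turning `x₂`'s into `x₁`'s
    have h2 : v 2 = u 2 := heq 2 (by decide)
    have h1 : v 1 < u 1 := hj
    have hu' : u = u.erase 1 + Finsupp.single 1 (v 1 + (u 1 - v 1)) := by
      rw [Nat.add_sub_cancel' h1.le, Finsupp.erase_add_single]
    have hmem := hu.prop
    rw [hu'] at hmem
    have hv : v = u.erase 1 + (Finsupp.single 1 (v 1) + Finsupp.single 0 (u 1 - v 1)) := by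
      ext k
      fin_cases k <;> simp <;> omega
    rw [hv]
    exact hI.monomial_exchange_mem (by decide) (by simp) _ _ hmem
  · -- `x₃ ^ u₃` kills the nonzero class of `w`, so it is surjective onto the degree of `u`
    have h2 : v 2 < u 2 := hj
    have hu' : u.erase 2 + Finsupp.single 2 (u 2) = u := Finsupp.erase_add_single _ _
    set w := u.erase 2 with hw
    have hwI : monomial w (1 : K) ∉ I := fun h => by
      have hle : w ≤ u := by rw [← hu']; exact le_self_add
      have := hu.le_of_le h hle 2
      simp [hw] at this
      omega
    have hwd : w.degree + u 2 = v.degree := by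
      rw [hdeg, ← hu']
      simp [hw]
    rcases hI.last_isLefschetz hS w.degree (s := u 2) (by omega) with hinj | hsurj
    · refine absurd (hinj _ (isHomogeneous_monomial 1 rfl) ?_) hwI
      rw [X_pow_eq_monomial, monomial_mul, one_mul, add_comm _ w, show w + Finsupp.single (Fin.last 2) (u 2) = u from hu']
      exact hu.prop
    · obtain ⟨q, hq⟩ := hsurj (monomial v 1) (isHomogeneous_monomial 1 hwd.symm)
      -- no monomial of `x₃ ^ u₃ * q` is `x ^ v`, as `v₃ < u₃`
      refine hI.isMonomialIdeal.monomial_mem hq (mem_support_iff.mpr ?_)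
      rw [coeff_sub, X_pow_eq_monomial, coeff_monomial_mul', if_neg, coeff_monomial, if_pos rfl]
      · simp
      · intro hle
        have := hle 2
        simp [hlast] at this
        omega

end Lefschetz


theorem mainTheorem5 {K : Type*} [Field K] [CharZero K]
    (I : Ideal (MvPolynomial (Fin 3) K))
    (hArt : IsArtinianRing (MvPolynomial (Fin 3) K ⧸ I))
    (hBorel : Lefschetz.IsBorelFixed I)
    (hSLP : Lefschetz.HasSLP (Lefschetz.quotientComponent I)) :
    (Lefschetz.IsAlmostRevlex I ∧
      ∀ J : Ideal (MvPolynomial (Fin 3) K), Lefschetz.IsAlmostRevlex J →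
        Lefschetz.hilbertFunction J = Lefschetz.hilbertFunction I → J = I) ∧
    (∀ J : Ideal (MvPolynomial (Fin 3) K),
      IsArtinianRing (MvPolynomial (Fin 3) K ⧸ J) →
      Lefschetz.IsBorelFixed J → Lefschetz.HasSLP (Lefschetz.quotientComponent J) →
      Lefschetz.hilbertFunction J = Lefschetz.hilbertFunction I → J = I) := by
  have hrev := hBorel.isAlmostRevlex hSLP
  exact ⟨⟨hrev, fun J hJ h => hrev.eq_of_hilbertFunction_eq hJ h⟩,
    fun J _ hJB hJS h => hrev.eq_of_hilbertFunction_eq (hJB.isAlmostRevlex hJS) h⟩
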